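/- Let $(\Omega,\mathcal A,\mathbb P)$ be a probability space and let $U_t=(U_{1,t},U_{2,t})$ and $X_t\in\mathbb R^m$, $t\in\mathbb Z$, be random vectors such that $U_{1,t}$ and $U_{2,t}$ are uniformly distributed on $[0,1]$ (with an arbitrary dependence between them). For $t\in\mathbb Z$ let $\mathcal F_t=\sigma\big((U_s,X_s):s\le t\big)$. Assume that the process $\big((U_t,X_t)\big)_{t\in\mathbb Z}$ is stationary and ergodic and that $U_t$ is independent of $\mathcal F_{t-1}$ for every $t\in\mathbb Z$. Let $d\in\mathbb R^2$, let $A,B$ be real $2\times2$ matrices and let $\Gamma$ be a real $2\times m$ matrix. The binary-Poisson (BIP) model is $$Y_{1,t}=\mathbf 1_{\{U_{1,t}\ge 1-F(\lambda_{1,t})\}},\quad F(s)=\frac1{1+e^{-s}},\qquad Y_{2,t}=\inf\Big\{y\in\mathbb N:\ \sum_{j=0}^{y}e^{-e^{\lambda_{2,t}}}\frac{e^{j\lambda_{2,t}}}{j!}\ge U_{2,t}\Big\},$$ $$\lambda_t=d+B\lambda_{t-1}+A\overline Y_{t-1}+\Gamma X_{t-1},\qquad \overline Y_t=\big(Y_{1,t},\log(1+Y_{2,t})\big)',\qquad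 t\in\mathbb Z.$$ For a matrix $C$ let $|C|_{vec}$ be the matrix of the absolute values of its entries, $\rho(C)$ its spectral radius and $|C|_\infty=\max_i\sum_j|C(i,j)|$; let $|x|_1=\sum_i|x_i|$; and let $\overline A$ be the matrix obtained from $A$ by replacing its first column by the null vector. **Proposition.** Assume that $X_0$ is integrable, that $\rho\big(|B|_{vec}+|A|_{vec}\,\mathrm{diag}(1/4,1)\big)<1$, that $\big||\overline A|_{vec}+|B|_{vec}\big|_\infty<1$, and that $\mathbb E\exp(r|X_0|_1)<\infty$ for every $r>0$. Let $\big((Y_t,\lambda_t)\big)_{t\in\mathbb Z}$ be a stationary, $(\mathcal F_t)_{t\in\mathbb Z}$-adapted process that satisfies the equations of the model almost surely and is such that $\mathbb E|\lambda_0|_1<\infty$. Then, for every $r>0$, $$\mathbb E\exp\big(r|\lambda_0|_1\big)<\infty\qquad\text{and}\qquad \mathbb E\big(|Y_0|_1^r\big)<\infty .$$ -/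

import Mathlib

open MeasureTheory ProbabilityTheory

namespace BIP

/-- The `ℓ¹` norm `|x|₁` on `ℝʲ`. -/
noncomputable def l1 {j : ℕ} (x : Fin j → ℝ) : ℝ := ∑ i, |x i|

/-- The matrix `|C|_vec` of absolute values of the entries of `C`. -/
def absMat (C : Matrix (Fin 2) (Fin 2) ℝ) : Matrix (Fin 2) (Fin 2) ℝ :=
  C.map (fun c => |c|)

/-- The spectral radius of a real matrix: the largest modulus of its complex eigenvalues. -/
noncomputable def rho (C : Matrix (Fin 2) (Fin 2) ℝ) : ENNReal :=
  spectralRadius ℂ (C.map (fun c => (c : ℂ)))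

/-- The norm `|C|_∞`, the maximal absolute row sum. -/
noncomputable def infNorm (C : Matrix (Fin 2) (Fin 2) ℝ) : ℝ := ⨆ i, ∑ j, |C i j|

/-- The matrix obtained from `A` by replacing its first column by the null vector. -/
def dropFirstCol (A : Matrix (Fin 2) (Fin 2) ℝ) : Matrix (Fin 2) (Fin 2) ℝ :=
  A.updateCol 0 0

/-- The shift on the space of trajectories indexed by `ℤ`. -/
def shift {S : Type*} (z : ℤ → S) : ℤ → S := fun t => z (t + 1)

/-- The law of a process indexed by `ℤ`, as a measure on the space of trajectories. -/
noncomputable def pathLaw {Ω S : Type*} [MeasurableSpace Ω] [MeasurableSpace S]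
    (P : Measure Ω) (Z : ℤ → Ω → S) : Measure (ℤ → S) :=
  P.map (fun ω t => Z t ω)

/-- (Strict) stationarity: the law of the process is shift invariant. -/
def Stationary {Ω S : Type*} [MeasurableSpace Ω] [MeasurableSpace S]
    (P : Measure Ω) (Z : ℤ → Ω → S) : Prop :=
  MeasurePreserving shift (pathLaw P Z) (pathLaw P Z)

/-- A stationary and ergodic process (`Ergodic` contains the invariance of the measure). -/
def StationaryErgodic {Ω S : Type*} [MeasurableSpace Ω] [MeasurableSpace S]
    (P : Measure Ω) (Z : ℤ → Ω → S) : Prop :=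
  Ergodic shift (pathLaw P Z)

/-- The sigma-field `𝓕_t` generated by the random vectors `(U_s, X_s)`, `s ≤ t`. -/
abbrev past {Ω : Type*} {m : ℕ} (U : ℤ → Ω → Fin 2 → ℝ) (X : ℤ → Ω → Fin m → ℝ) (t : ℤ) :
    MeasurableSpace Ω :=
  ⨆ s : ℤ, ⨆ _ : s ≤ t, MeasurableSpace.comap (fun ω => (U s ω, X s ω)) inferInstance

/-- The noise `U` and the covariates `X`: each `U_t` is distributed according to a copula, the
process `((U_t, X_t))` is stationary and ergodic, and `U_t` is independent of `𝓕_{t-1}`. -/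
structure IsDriver {Ω : Type*} [MeasurableSpace Ω] (P : Measure Ω) {m : ℕ}
    (U : ℤ → Ω → Fin 2 → ℝ) (X : ℤ → Ω → Fin m → ℝ) : Prop where
  measurable_U : ∀ t, Measurable (U t)
  measurable_X : ∀ t, Measurable (X t)
  uniform_U : ∀ t i, P.map (fun ω => U t ω i) = volume.restrict (Set.Icc (0 : ℝ) 1)
  stationaryErgodic : StationaryErgodic P (fun t ω => (U t ω, X t ω))
  indep : ∀ t, Indep (MeasurableSpace.comap (U t) inferInstance) (past U X (t - 1)) P

/-- The logistic function. -/
noncomputable def logistic (s : ℝ) : ℝ := 1 / (1 + Real.exp (-s))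

open Classical in
/-- The binary coordinate `𝟙{u ≥ 1 - F(s)}`, `F` the logistic function. -/
noncomputable def binaryQuantile (s u : ℝ) : ℕ := if 1 - logistic s ≤ u then 1 else 0

/-- The Poisson coordinate `inf {y : ∑_{j ≤ y} e^{-e^s} e^{js} / j! ≥ u}`. The set is nonempty
for `u < 1`. -/
noncomputable def poissonQuantile (s u : ℝ) : ℕ :=
  sInf {y : ℕ | u ≤ ∑ j ∈ Finset.range (y + 1),
    Real.exp (-Real.exp s) * Real.exp (j * s) / (Nat.factorial j : ℝ)}

/-- The transform `(y₁, log (1 + y₂))`. -/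
noncomputable def bar (y : Fin 2 → ℕ) : Fin 2 → ℝ := ![(y 0 : ℝ), Real.log (1 + (y 1 : ℝ))]

/-- `(Y, lam)` solves the equations of the binary-Poisson model driven by `(U, X)`. -/
structure IsSolution {Ω : Type*} [MeasurableSpace Ω] (P : Measure Ω) {m : ℕ}
    (d : Fin 2 → ℝ) (B A : Matrix (Fin 2) (Fin 2) ℝ) (Γ : Matrix (Fin 2) (Fin m) ℝ)
    (U : ℤ → Ω → Fin 2 → ℝ) (X : ℤ → Ω → Fin m → ℝ)
    (Y : ℤ → Ω → Fin 2 → ℕ) (lam : ℤ → Ω → Fin 2 → ℝ) : Prop where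
  binary : ∀ t, ∀ᵐ ω ∂P, Y t ω 0 = binaryQuantile (lam t ω 0) (U t ω 0)
  count : ∀ t, ∀ᵐ ω ∂P, Y t ω 1 = poissonQuantile (lam t ω 1) (U t ω 1)
  latent : ∀ t, ∀ᵐ ω ∂P, lam t ω =
    d + B.mulVec (lam (t - 1) ω) + A.mulVec (bar (Y (t - 1) ω)) + Γ.mulVec (X (t - 1) ω)

/-- `(Y, lam)` is a stationary, `𝓕_t`-adapted solution with `E |lam_0|₁ < ∞`. -/
structure IsStationarySolution {Ω : Type*} [MeasurableSpace Ω] (P : Measure Ω) {m : ℕ}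
    (d : Fin 2 → ℝ) (B A : Matrix (Fin 2) (Fin 2) ℝ) (Γ : Matrix (Fin 2) (Fin m) ℝ)
    (U : ℤ → Ω → Fin 2 → ℝ) (X : ℤ → Ω → Fin m → ℝ)
    (Y : ℤ → Ω → Fin 2 → ℕ) (lam : ℤ → Ω → Fin 2 → ℝ) : Prop
    extends IsSolution P d B A Γ U X Y lam where
  adapted_Y : ∀ t, Measurable[past U X t] (Y t)
  adapted_lam : ∀ t, Measurable[past U X t] (lam t)
  stationary : Stationary P (fun t ω => (Y t ω, lam t ω))
  integrable : Integrable (fun ω => l1 (lam 0 ω)) P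

end BIP

namespace BIP

/-! The latent recursion contracts in sup norm up to light-tailed noise: `‖λ_t‖ ≤ κ‖λ_{t-1}‖ + c + W
+ γ|X|₁` with `κ < 1`, where `W` is the positive part of `log (1 + Y₂) - |λ₂|` at time `t-1`
(`norm_latent_step_le`). Convexity of `exp` turns this into `exp (r‖λ_t‖) ≤ κ exp (r‖λ_{t-1}‖) + g`.
Here `g` is integrable: `X` has all exponential moments, and so does `W`, because given `λ₂` the
count is Poisson and `(1 + Y₂) e^{-|λ₂|}` has a bounded exponential moment
(`lintegral_exp_poissonQuantile_le`). Stationarity and truncation then give integrability with no a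
priori moment of `exp (r‖λ‖)` (`lintegral_ne_top_of_identDistrib_of_le_mul_add`). -/

/-! ### Integrability from an affine inequality in law -/

open Filter Topology in
/-- A nonnegative, almost surely finite random variable `f` with a copy `f'` in law such that
`f' ≤ κ f + g`, where `κ < 1` and `g` is integrable, is integrable. -/
theorem lintegral_ne_top_of_identDistrib_of_le_mul_add {Ω : Type*} [MeasurableSpace Ω]
    {P : Measure Ω} [IsFiniteMeasure P] {f f' g : Ω → ENNReal} {κ : ENNReal}
    (hf : ∀ᵐ ω ∂P, f ω ≠ ⊤) (hff' : IdentDistrib f' f P P) (hκ : κ < 1)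
    (hle : ∀ᵐ ω ∂P, f' ω ≤ κ * f ω + g ω) (hgm : AEMeasurable g P)
    (hg : ∫⁻ ω, g ω ∂P ≠ ⊤) : ∫⁻ ω, f ω ∂P ≠ ⊤ := by
  have hfm : AEMeasurable f P := hff'.aemeasurable_snd
  have key : ∀ M : ℕ, ∫⁻ ω, min (f ω) M ∂P ≤ (1 - κ)⁻¹ * ∫⁻ ω, g ω ∂P := by
    intro M
    -- Truncating at `M` keeps every integral finite; the inequality is iterated on `κ ^ n * f`, and
    -- dominated convergence removes the remainder.
    set h : ℕ → ENNReal := fun n => ∫⁻ ω, min (κ ^ n * f ω) M ∂P with hh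
    have hstep : ∀ n, h n ≤ h (n + 1) + κ ^ n * ∫⁻ ω, g ω ∂P := by
      intro n
      have e : h n = ∫⁻ ω, min (κ ^ n * f' ω) M ∂P := by
        have := (hff'.comp (u := fun x : ENNReal => min (κ ^ n * x) M)
          ((measurable_id.const_mul _).min measurable_const)).lintegral_eq
        exact this.symm
      rw [e, ← lintegral_const_mul'' _ hgm, ← lintegral_add_right' _ (hgm.const_mul _)]
      refine lintegral_mono_ae ?_
      filter_upwards [hle] with ω hω
      have h1 : κ ^ n * f' ω ≤ κ ^ (n + 1) * f ω + κ ^ n * g ω := by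
        calc κ ^ n * f' ω ≤ κ ^ n * (κ * f ω + g ω) := by gcongr
          _ = _ := by ring
      -- The level is raised by the noise term so that this term leaves the minimum.
      calc min (κ ^ n * f' ω) (M : ENNReal)
          ≤ min (κ ^ (n + 1) * f ω + κ ^ n * g ω) (M + κ ^ n * g ω) :=
            min_le_min h1 le_self_add
        _ = _ := min_add_add_right _ _ _
    have hsum : ∀ n, h 0 ≤ h n + (∑ k ∈ Finset.range n, κ ^ k) * ∫⁻ ω, g ω ∂P := by
      intro n
      induction n with
      | zero => simp
      | succ n ih =>
        refine ih.trans ?_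
        rw [Finset.sum_range_succ, add_mul, add_comm (_ * _) (κ ^ n * _), ← add_assoc]
        gcongr
        exact hstep n
    have hlim : Tendsto h atTop (𝓝 0) := by
      have := tendsto_lintegral_of_dominated_convergence' (μ := P)
        (F := fun n ω => min (κ ^ n * f ω) (M : ENNReal)) (f := fun _ => 0) (fun _ => (M : ENNReal))
        (fun n => (hfm.const_mul _).min aemeasurable_const)
        (fun n => ae_of_all _ fun ω => min_le_right _ _)
        (by simp [ENNReal.mul_eq_top])
        (by
          filter_upwards [hf] with ω hω
          have h0 := ENNReal.Tendsto.mul_const (b := f ω)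
            (ENNReal.tendsto_pow_atTop_nhds_zero_of_lt_one hκ) (Or.inr hω)
          have h2 := h0.min (tendsto_const_nhds (x := (M : ENNReal)))
          simpa using h2)
      simpa using this
    have h0 : h 0 ≤ 0 + (1 - κ)⁻¹ * ∫⁻ ω, g ω ∂P := by
      refine ge_of_tendsto' (hlim.add_const _) fun n => (hsum n).trans ?_
      gcongr
      rw [← ENNReal.tsum_geometric]
      exact ENNReal.sum_le_tsum _
    simpa [hh] using h0
  have hsup : ∫⁻ ω, f ω ∂P = ⨆ M : ℕ, ∫⁻ ω, min (f ω) M ∂P := by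
    rw [← lintegral_iSup' (fun M => hfm.min aemeasurable_const)
      (ae_of_all _ fun ω a b hab => min_le_min_left _ (by exact_mod_cast hab))]
    refine lintegral_congr fun ω => ?_
    rw [← inf_iSup_eq, ENNReal.iSup_natCast]
    simp
  rw [hsup]
  refine ne_top_of_le_ne_top (ENNReal.mul_ne_top ?_ hg) (iSup_le key)
  simpa [tsub_eq_zero_iff_le] using hκ

/-! ### Poisson quantiles and exponential moments -/

/-- The Poisson distribution function with parameter `e^s`. -/
noncomputable def poissonCdf (s : ℝ) (n : ℕ) : ℝ :=
  ∑ j ∈ Finset.range n, Real.exp (-Real.exp s) * Real.exp (j * s) / (Nat.factorial j : ℝ)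

theorem tendsto_poissonCdf (s : ℝ) :
    Filter.Tendsto (poissonCdf s) Filter.atTop (nhds 1) := by
  have h := (NormedSpace.expSeries_div_hasSum_exp (𝔸 := ℝ) (Real.exp s)).mul_left
    (Real.exp (-Real.exp s))
  rw [← Real.exp_eq_exp_ℝ, ← Real.exp_add, neg_add_cancel, Real.exp_zero] at h
  refine h.tendsto_sum_nat.congr fun n => Finset.sum_congr rfl fun j _ => ?_
  rw [Real.exp_nat_mul, mul_div_assoc]

theorem measurable_poissonCdf (n : ℕ) : Measurable fun s => poissonCdf s n := by
  unfold poissonCdf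
  fun_prop

/-- On `(0, 1)` the quantile `k` is attained exactly between consecutive values of the
distribution function. -/
theorem poissonCdf_poissonQuantile {s u : ℝ} (h0 : 0 < u) (h1 : u < 1) :
    poissonCdf s (poissonQuantile s u) < u ∧ u ≤ poissonCdf s (poissonQuantile s u + 1) := by
  have hne : {y : ℕ | u ≤ poissonCdf s (y + 1)}.Nonempty := by
    obtain ⟨n, hn⟩ := ((((tendsto_poissonCdf s).comp
      (Filter.tendsto_add_atTop_nat 1)).eventually (lt_mem_nhds h1))).exists
    exact ⟨n, hn.le⟩
  refine ⟨?_, Nat.sInf_mem hne⟩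
  rcases hq : poissonQuantile s u with _ | k
  · simpa [poissonCdf] using h0
  · have : k ∉ {y : ℕ | u ≤ poissonCdf s (y + 1)} :=
      Nat.notMem_of_lt_sInf (by
        change k < poissonQuantile s u
        omega)
    simpa using this

/-- The count `1 + Y`, with `Y` Poisson of parameter `e^s`, normalized by `e^|s|`, has an
exponential moment that is bounded in `s`. -/
theorem tsum_poisson_exp_le (s : ℝ) :
    ∑' k : ℕ, ENNReal.ofReal (Real.exp ((1 + (k : ℝ)) * Real.exp (-|s|))) *
      ENNReal.ofReal (poissonCdf s (k + 1) - poissonCdf s k) ≤ ENNReal.ofReal (Real.exp 3) := by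
  set θ := Real.exp (-|s|) with hθ
  have hθ0 : 0 < θ := Real.exp_pos _
  have hθ1 : θ ≤ 1 := Real.exp_le_one_iff.2 (by simp)
  have hs : Real.exp s * θ ≤ 1 := by
    rw [hθ, ← Real.exp_add]
    exact Real.exp_le_one_iff.2 (by linarith [le_abs_self s])
  -- Exponential tilting: the weights become those of parameter `e^s e^θ`, up to normalization.
  have hterm : ∀ k : ℕ, Real.exp ((1 + (k : ℝ)) * θ) * (poissonCdf s (k + 1) - poissonCdf s k) =
      Real.exp (θ - Real.exp s) * ((Real.exp s * Real.exp θ) ^ k / (k.factorial : ℝ)) := by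
    intro k
    rw [poissonCdf, Finset.sum_range_succ, ← poissonCdf, add_sub_cancel_left, mul_pow,
      ← Real.exp_nat_mul, ← Real.exp_nat_mul, ← mul_div_assoc, ← mul_div_assoc]
    simp only [← Real.exp_add]
    congr 2
    ring
  have hsum := (NormedSpace.expSeries_div_hasSum_exp (𝔸 := ℝ) (Real.exp s * Real.exp θ)).mul_left
    (Real.exp (θ - Real.exp s))
  rw [← Real.exp_eq_exp_ℝ, ← Real.exp_add (θ - Real.exp s)] at hsum
  simp_rw [← ENNReal.ofReal_mul (Real.exp_pos _).le, hterm]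
  rw [← ENNReal.ofReal_tsum_of_nonneg (fun k => by positivity) hsum.summable, hsum.tsum_eq]
  refine ENNReal.ofReal_le_ofReal (Real.exp_le_exp.2 ?_)
  -- The total exponent is `θ + e^s (e^θ - 1) ≤ θ + 2 e^s θ ≤ 3`.
  have hexp : Real.exp θ - 1 ≤ 2 * θ := by
    have := Real.abs_exp_sub_one_le (x := θ) (by rw [abs_of_pos hθ0]; exact hθ1)
    rw [abs_of_pos hθ0] at this
    exact (le_abs_self _).trans this
  nlinarith [Real.exp_pos s]

/-- The inverse transform turns a uniform variable into a Poisson variable; stated for a pair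
`(s, u)` of independent variables. -/
theorem lintegral_exp_poissonQuantile_le {Ω : Type*} [MeasurableSpace Ω] {P : Measure Ω}
    [IsProbabilityMeasure P] {S V : Ω → ℝ} (hS : Measurable S) (hV : Measurable V)
    (hind : IndepFun S V P) (hlaw : P.map V = volume.restrict (Set.Icc (0 : ℝ) 1)) :
    ∫⁻ ω, ENNReal.ofReal (Real.exp ((1 + (poissonQuantile (S ω) (V ω) : ℝ)) *
      Real.exp (-|S ω|))) ∂P ≤ ENNReal.ofReal (Real.exp 3) := by
  let w : ℕ → ℝ → ENNReal := fun k s => ENNReal.ofReal (Real.exp ((1 + (k : ℝ)) * Real.exp (-|s|)))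
  let T : ℕ → Set (ℝ × ℝ) := fun k => {p | poissonCdf p.1 k < p.2 ∧ p.2 ≤ poissonCdf p.1 (k + 1)}
  have hT : ∀ k, MeasurableSet (T k) := fun k =>
    (measurableSet_lt ((measurable_poissonCdf k).comp measurable_fst) measurable_snd).inter
      (measurableSet_le measurable_snd ((measurable_poissonCdf (k + 1)).comp measurable_fst))
  have hw : ∀ k, Measurable (w k) := fun k => by fun_prop
  -- A measurable majorant, which avoids proving `poissonQuantile` jointly measurable.
  let H : ℝ × ℝ → ENNReal := fun p => ∑' k, (T k).indicator (fun p => w k p.1) p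
  have hH : Measurable H :=
    Measurable.tsum fun k => ((hw k).comp measurable_fst).indicator (hT k)
  have hV01 : ∀ᵐ ω ∂P, V ω ∈ Set.Ioo (0 : ℝ) 1 := by
    refine ae_of_ae_map hV.aemeasurable ?_
    rw [hlaw, ← restrict_Ioo_eq_restrict_Icc]
    exact ae_restrict_mem measurableSet_Ioo
  have hprod : P.map (fun ω => (S ω, V ω)) = (P.map S).prod (P.map V) :=
    (indepFun_iff_map_prod_eq_prod_map_map hS.aemeasurable hV.aemeasurable).1 hind
  have := Measure.isProbabilityMeasure_map (μ := P) hS.aemeasurable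
  have := Measure.isProbabilityMeasure_map (μ := P) hV.aemeasurable
  calc _ ≤ ∫⁻ ω, H (S ω, V ω) ∂P := by
        refine lintegral_mono_ae ?_
        filter_upwards [hV01] with ω hω
        refine le_trans ?_ (ENNReal.le_tsum (poissonQuantile (S ω) (V ω)))
        rw [Set.indicator_of_mem]
        exact poissonCdf_poissonQuantile hω.1 hω.2
    _ = ∫⁻ s, ∫⁻ u, H (s, u) ∂(P.map V) ∂(P.map S) := by
        rw [← lintegral_map hH (hS.prodMk hV), hprod, lintegral_prod _ hH.aemeasurable]
    _ ≤ ∫⁻ s, ENNReal.ofReal (Real.exp 3) ∂(P.map S) := by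
        refine lintegral_mono fun s => ?_
        refine le_trans ?_ (tsum_poisson_exp_le s)
        have hm : ∀ k, Measurable fun u => (T k).indicator (fun p => w k p.1) (s, u) := fun k =>
          (((hw k).comp measurable_fst).indicator (hT k)).comp measurable_prodMk_left
        change ∫⁻ u, ∑' k, (T k).indicator (fun p => w k p.1) (s, u) ∂(P.map V) ≤ _
        rw [lintegral_tsum fun k => (hm k).aemeasurable]
        refine ENNReal.tsum_le_tsum fun k => ?_
        have e : (fun u => (T k).indicator (fun p => w k p.1) (s, u)) =
            (Set.Ioc (poissonCdf s k) (poissonCdf s (k + 1))).indicator (fun _ => w k s) := rfl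
        rw [e, lintegral_indicator_const measurableSet_Ioc, hlaw]
        gcongr
        exact (Measure.restrict_apply_le _ _).trans_eq Real.volume_Ioc
    _ = _ := by simp

/-! ### Stationarity, norms and the one-step contraction -/

theorem Stationary.identDistrib {Ω S : Type*} [MeasurableSpace Ω] [MeasurableSpace S]
    {P : Measure Ω} {Z : ℤ → Ω → S} (h : Stationary P Z) (hZ : ∀ t, Measurable (Z t)) (t : ℤ) :
    IdentDistrib (Z (t + 1)) (Z t) P P := by
  refine ⟨(hZ _).aemeasurable, (hZ _).aemeasurable, ?_⟩
  have hm : Measurable fun ω t => Z t ω := measurable_pi_lambda _ hZ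
  have e := congrArg (Measure.map fun z : ℤ → S => z t) h.map_eq
  rw [Measure.map_map (measurable_pi_apply t) h.measurable, pathLaw,
    Measure.map_map ((measurable_pi_apply t).comp h.measurable) hm,
    Measure.map_map (measurable_pi_apply t) hm] at e
  exact e

theorem l1_nonneg {j : ℕ} (x : Fin j → ℝ) : 0 ≤ l1 x := Finset.sum_nonneg fun _ _ => abs_nonneg _

theorem measurable_l1 {j : ℕ} : Measurable (l1 : (Fin j → ℝ) → ℝ) := by
  unfold l1
  fun_prop

theorem l1_le_two_mul_norm (x : Fin 2 → ℝ) : l1 x ≤ 2 * ‖x‖ := by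
  have h0 := norm_le_pi_norm x 0
  have h1 := norm_le_pi_norm x 1
  rw [Real.norm_eq_abs] at h0 h1
  rw [l1, Fin.sum_univ_two]
  linarith

theorem measurable_bar : Measurable bar := measurable_of_countable _

/-- The excess of the transformed count over the modulus of the latent count coordinate. -/
noncomputable def excess (y : ℕ) (s : ℝ) : ℝ := max 0 (Real.log (1 + (y : ℝ)) - |s|)

theorem excess_nonneg (y : ℕ) (s : ℝ) : 0 ≤ excess y s := le_max_left _ _

/-- A positive excess gives `z ^ p` with `z = (1 + y) e^{-|s|}`, and `z ^ p ≤ p! e^z`; the summand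
`1` covers a zero excess. -/
theorem exp_mul_excess_le (p y : ℕ) (s : ℝ) :
    Real.exp (p * excess y s) ≤
      1 + p.factorial * Real.exp ((1 + (y : ℝ)) * Real.exp (-|s|)) := by
  rcases max_choice 0 (Real.log (1 + (y : ℝ)) - |s|) with h | h
  · rw [excess, h, mul_zero, Real.exp_zero]
    have : 0 ≤ (p.factorial : ℝ) * Real.exp ((1 + (y : ℝ)) * Real.exp (-|s|)) := by positivity
    linarith
  · have h1 : Real.exp (p * (Real.log (1 + (y : ℝ)) - |s|)) =
        ((1 + (y : ℝ)) * Real.exp (-|s|)) ^ p := by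
      rw [Real.exp_nat_mul, sub_eq_add_neg, Real.exp_add, Real.exp_log (by positivity)]
    have h2 := Real.pow_div_factorial_le_exp ((1 + (y : ℝ)) * Real.exp (-|s|)) (by positivity) p
    rw [div_le_iff₀ (by positivity)] at h2
    rw [excess, h, h1]
    linarith

/-- The first column of `A` can be dropped since it multiplies a bounded binary variable, which only
adds a constant. -/
theorem abs_row_sum_le (A B : Matrix (Fin 2) (Fin 2) ℝ) (i : Fin 2) :
    |A i 1| + |B i 0| + |B i 1| ≤ infNorm (absMat (dropFirstCol A) + absMat B) := by
  refine le_trans (le_of_eq ?_) (le_ciSup (f := fun i => ∑ j, |(absMat (dropFirstCol A) +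
    absMat B) i j|) (Set.finite_range _).bddAbove i)
  have h : ∀ a b : ℝ, |(|a| + |b|)| = |a| + |b| := fun a b => abs_of_nonneg (by positivity)
  simp [Fin.sum_univ_two, absMat, dropFirstCol, Matrix.updateCol_apply, h]
  ring

/-- One step of the latent recursion contracts the supremum norm, up to a term with light tails. -/
theorem norm_latent_step_le {m : ℕ} (d : Fin 2 → ℝ) (B A : Matrix (Fin 2) (Fin 2) ℝ)
    (Γ : Matrix (Fin 2) (Fin m) ℝ) {κ : ℝ} (hκ1 : κ ≤ 1)
    (hκ : infNorm (absMat (dropFirstCol A) + absMat B) ≤ κ) (l : Fin 2 → ℝ) {y : Fin 2 → ℕ}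
    (hy : y 0 ≤ 1) (x : Fin m → ℝ) :
    ‖d + B.mulVec l + A.mulVec (bar y) + Γ.mulVec x‖ ≤
      κ * ‖l‖ + ((‖d‖ + ∑ i, |A i 0|) + excess (y 1) (l 1) + (∑ i, ∑ j, |Γ i j|) * l1 x) := by
  have hW := excess_nonneg (y 1) (l 1)
  have hl : ∀ i, |l i| ≤ ‖l‖ := fun i => norm_le_pi_norm l i
  have hκ0 : 0 ≤ κ := le_trans (by positivity) ((abs_row_sum_le A B 0).trans hκ)
  have hx := l1_nonneg x
  refine (pi_norm_le_iff_of_nonneg (by positivity)).2 fun i => ?_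
  have hrow := (abs_row_sum_le A B i).trans hκ
  have hd : |d i| ≤ ‖d‖ := norm_le_pi_norm d i
  have hA0 : |A i 0| ≤ ∑ i, |A i 0| :=
    Finset.single_le_sum (f := fun i => |A i 0|) (fun _ _ => abs_nonneg _) (Finset.mem_univ i)
  have hΓ : |Γ.mulVec x i| ≤ (∑ i, ∑ j, |Γ i j|) * l1 x := by
    calc |Γ.mulVec x i| ≤ ∑ j, |Γ i j * x j| := by
          rw [Matrix.mulVec, dotProduct]
          exact Finset.abs_sum_le_sum_abs _ _
      _ ≤ ∑ j, |Γ i j| * l1 x := by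
        refine Finset.sum_le_sum fun j _ => ?_
        rw [abs_mul]
        gcongr
        exact Finset.single_le_sum (f := fun j => |x j|) (fun _ _ => abs_nonneg _)
          (Finset.mem_univ j)
      _ = (∑ j, |Γ i j|) * l1 x := (Finset.sum_mul _ _ _).symm
      _ ≤ _ := by
        gcongr
        exact Finset.single_le_sum (f := fun i => ∑ j, |Γ i j|)
          (fun _ _ => Finset.sum_nonneg fun _ _ => abs_nonneg _) (Finset.mem_univ i)
  have hB : |B.mulVec l i| ≤ (|B i 0| + |B i 1|) * ‖l‖ := by
    rw [Matrix.mulVec, dotProduct, Fin.sum_univ_two, add_mul]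
    refine (abs_add_le _ _).trans ?_
    rw [abs_mul, abs_mul]
    gcongr <;> exact hl _
  have hA : |A.mulVec (bar y) i| ≤ |A i 0| + |A i 1| * (‖l‖ + excess (y 1) (l 1)) := by
    rw [Matrix.mulVec, dotProduct, Fin.sum_univ_two]
    refine (abs_add_le _ _).trans ?_
    rw [abs_mul, abs_mul]
    have hlog : 0 ≤ Real.log (1 + (y 1 : ℝ)) := Real.log_nonneg (by simp)
    have h1 : |bar y 1| ≤ ‖l‖ + excess (y 1) (l 1) := by
      have : Real.log (1 + (y 1 : ℝ)) - |l 1| ≤ excess (y 1) (l 1) := le_max_right _ _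
      simp only [bar, Matrix.cons_val_one, Matrix.cons_val_fin_one, abs_of_nonneg hlog]
      linarith [hl 1]
    have h0 : |bar y 0| ≤ 1 := by
      simpa [bar] using hy
    gcongr
    exact mul_le_of_le_one_right (abs_nonneg _) h0
  have htri : |d i + B.mulVec l i + A.mulVec (bar y) i + Γ.mulVec x i| ≤
      |d i| + |B.mulVec l i| + |A.mulVec (bar y) i| + |Γ.mulVec x i| :=
    (abs_add_le _ _).trans (by gcongr; exact abs_add_three _ _ _)
  have h1 : (|A i 1| + |B i 0| + |B i 1|) * ‖l‖ ≤ κ * ‖l‖ := by gcongr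
  have h2 : |A i 1| * excess (y 1) (l 1) ≤ excess (y 1) (l 1) :=
    mul_le_of_le_one_left hW (by linarith [abs_nonneg (B i 0), abs_nonneg (B i 1)])
  simp only [Pi.add_apply, Real.norm_eq_abs]
  linarith

theorem measurable_past_X {Ω : Type*} {m : ℕ} (U : ℤ → Ω → Fin 2 → ℝ) (X : ℤ → Ω → Fin m → ℝ)
    (t : ℤ) : Measurable[past U X t] (X t) := by
  have h : Measurable[past U X t] fun ω => (U t ω, X t ω) :=
    Measurable.of_comap_le (le_iSup₂_of_le t le_rfl le_rfl)
  exact measurable_snd.comp h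

/-! ### Exponential moments of stationary solutions -/

section Solution

variable {Ω : Type*} [MeasurableSpace Ω] {P : Measure Ω} {m : ℕ} {d : Fin 2 → ℝ}
  {B A : Matrix (Fin 2) (Fin 2) ℝ} {Γ : Matrix (Fin 2) (Fin m) ℝ} {U : ℤ → Ω → Fin 2 → ℝ}
  {X : ℤ → Ω → Fin m → ℝ} {Y : ℤ → Ω → Fin 2 → ℕ} {lam : ℤ → Ω → Fin 2 → ℝ}

theorem IsDriver.past_le (hUX : IsDriver P U X) (t : ℤ) : past U X t ≤ ‹MeasurableSpace Ω› :=
  iSup₂_le fun s _ => ((hUX.measurable_U s).prodMk (hUX.measurable_X s)).comap_le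

/-- The normalized count has a finite exponential moment. -/
theorem IsStationarySolution.integrable_exp_count [IsProbabilityMeasure P]
    (hUX : IsDriver P U X) (hsol : IsStationarySolution P d B A Γ U X Y lam) (t : ℤ) :
    Integrable (fun ω => Real.exp ((1 + (Y t ω 1 : ℝ)) * Real.exp (-|lam t ω 1|))) P := by
  have hY : Measurable (Y t) := (hsol.adapted_Y t).mono (hUX.past_le t) le_rfl
  have hlam : Measurable (lam t) := (hsol.adapted_lam t).mono (hUX.past_le t) le_rfl
  have hY1 : Measurable fun ω => (Y t ω 1 : ℝ) :=
    (measurable_of_countable fun y : Fin 2 → ℕ => (y 1 : ℝ)).comp hY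
  -- Adaptedness only places `lam t` in `𝓕_t`; its version `L` lies in `𝓕_{t-1}`, hence is
  -- independent of `U t`.
  let L : Ω → Fin 2 → ℝ := fun ω => d + B.mulVec (lam (t - 1) ω) +
    A.mulVec (bar (Y (t - 1) ω)) + Γ.mulVec (X (t - 1) ω)
  have hmul : ∀ {k : ℕ} (C : Matrix (Fin 2) (Fin k) ℝ), Measurable fun x => C.mulVec x :=
    fun C => (Continuous.matrix_mulVec continuous_const continuous_id).measurable
  have hL : Measurable[past U X (t - 1)] L :=
    Measurable.add (Measurable.add (Measurable.add measurable_const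
      ((hmul B).comp (hsol.adapted_lam (t - 1))))
      ((hmul A).comp (measurable_bar.comp (hsol.adapted_Y (t - 1)))))
      ((hmul Γ).comp (measurable_past_X U X (t - 1)))
  have hL1 : Measurable[past U X (t - 1)] fun ω => L ω 1 := (measurable_pi_apply 1).comp hL
  have hU1 : Measurable fun ω => U t ω 1 := (measurable_pi_apply 1).comp (hUX.measurable_U t)
  have hind : IndepFun (fun ω => L ω 1) (fun ω => U t ω 1) P := by
    rw [IndepFun_iff_Indep]
    refine indep_of_indep_of_le_left (indep_of_indep_of_le_right (hUX.indep t).symm ?_)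
      hL1.comap_le
    have : Measurable[MeasurableSpace.comap (U t) inferInstance] fun ω => U t ω 1 :=
      (measurable_pi_apply 1).comp (comap_measurable (U t))
    exact this.comap_le
  refine ⟨by fun_prop, ?_⟩
  rw [hasFiniteIntegral_iff_ofReal (ae_of_all _ fun ω => (Real.exp_pos _).le)]
  refine lt_of_le_of_lt (le_of_eq_of_le (lintegral_congr_ae ?_) (lintegral_exp_poissonQuantile_le
    (hL1.mono (hUX.past_le _) le_rfl) hU1 hind (hUX.uniform_U t 1))) ENNReal.ofReal_lt_top
  filter_upwards [hsol.count t, hsol.latent t] with ω h1 h2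
  have h3 : lam t ω = L ω := h2
  rw [h1, h3]

/-- All exponential moments of the latent process are finite. -/
theorem IsStationarySolution.integrable_exp_norm [IsProbabilityMeasure P]
    (hUX : IsDriver P U X) (hsol : IsStationarySolution P d B A Γ U X Y lam)
    (hnorm : infNorm (absMat (dropFirstCol A) + absMat B) < 1)
    (hexp : ∀ r : ℝ, 0 < r → Integrable (fun ω => Real.exp (r * l1 (X 0 ω))) P)
    {r : ℝ} (hr : 0 < r) : Integrable (fun ω => Real.exp (r * ‖lam 0 ω‖)) P := by
  have hYm : ∀ t, Measurable (Y t) := fun t => (hsol.adapted_Y t).mono (hUX.past_le t) le_rfl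
  have hlm : ∀ t, Measurable (lam t) := fun t => (hsol.adapted_lam t).mono (hUX.past_le t) le_rfl
  have hXm := hUX.measurable_X
  obtain ⟨κ, hκ, hκ1⟩ := exists_between hnorm
  have hκ0 : 0 ≤ κ := le_trans (by positivity) ((abs_row_sum_le A B 0).trans hκ.le)
  obtain ⟨p, hp⟩ := exists_nat_ge (2 * (r / (1 - κ)))
  set q : ℝ := r / (1 - κ) with hq
  have hq0 : 0 < q := div_pos hr (by linarith)
  set c : ℝ := ‖d‖ + ∑ i, |A i 0| with hc
  set γ : ℝ := ∑ i, ∑ j, |Γ i j| with hγ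
  have hγ0 : 0 ≤ γ := Finset.sum_nonneg fun _ _ => Finset.sum_nonneg fun _ _ => abs_nonneg _
  -- The factors `2` come from `e^{a+b} ≤ e^{2a} + e^{2b}`; `γ + 1` keeps the rate positive when `Γ
  -- = 0`.
  let g : Ω → ℝ := fun ω => Real.exp (q * c) *
    ((1 + p.factorial * Real.exp ((1 + (Y (-1) ω 1 : ℝ)) * Real.exp (-|lam (-1) ω 1|))) +
      Real.exp ((2 * q * (γ + 1)) * l1 (X (-1) ω)))
  have hidX : IdentDistrib (X 0) (X (-1)) P P := by
    have hst : Stationary P fun t ω => (U t ω, X t ω) := hUX.stationaryErgodic.toMeasurePreserving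
    exact (hst.identDistrib (fun t => (hUX.measurable_U t).prodMk (hXm t)) (-1)).comp measurable_snd
  have hidL : IdentDistrib (lam 0) (lam (-1)) P P :=
    have hst : IdentDistrib (fun ω => (Y 0 ω, lam 0 ω)) (fun ω => (Y (-1) ω, lam (-1) ω)) P P :=
      by simpa only [neg_add_cancel] using
        hsol.stationary.identDistrib (fun t => (hYm t).prodMk (hlm t)) (-1)
    hst.comp measurable_snd
  have hgX : Integrable (fun ω => Real.exp ((2 * q * (γ + 1)) * l1 (X (-1) ω))) P :=
    (hidX.comp (u := fun x => Real.exp ((2 * q * (γ + 1)) * l1 x))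
      (Real.measurable_exp.comp (measurable_l1.const_mul _))).integrable_iff.1
      (hexp _ (by positivity))
  have hg : Integrable g P := (((integrable_const _).add
    ((hsol.integrable_exp_count hUX (-1)).const_mul _)).add hgX).const_mul _
  have hg0 : ∀ ω, 0 ≤ g ω := fun ω => by positivity
  have hle : ∀ᵐ ω ∂P, Real.exp (r * ‖lam 0 ω‖) ≤ κ * Real.exp (r * ‖lam (-1) ω‖) + g ω := by
    filter_upwards [hsol.latent 0, hsol.binary (-1)] with ω h1 h2
    have hy : Y (-1) ω 0 ≤ 1 := by
      rw [h2, binaryQuantile]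
      split_ifs <;> simp
    have hstep := norm_latent_step_le d B A Γ hκ1.le hκ.le (lam (-1) ω) hy (X (-1) ω)
    rw [zero_sub] at h1
    rw [← h1, ← hc, ← hγ] at hstep
    set W := excess (Y (-1) ω 1) (lam (-1) ω 1) with hW
    have hW0 : 0 ≤ W := excess_nonneg _ _
    set x := l1 (X (-1) ω)
    have hx0 : 0 ≤ x := l1_nonneg _
    -- Since `(1 - κ) q = r`, the combination with weights `κ`, `1 - κ` is `r` times the one-step
    -- bound.
    have hconv := convexOn_exp.2 (Set.mem_univ (r * ‖lam (-1) ω‖))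
      (Set.mem_univ (q * (c + W + γ * x))) hκ0 (by linarith : 0 ≤ 1 - κ) (by ring)
    simp only [smul_eq_mul] at hconv
    have hexpand : κ * (r * ‖lam (-1) ω‖) + (1 - κ) * (q * (c + W + γ * x)) =
        r * (κ * ‖lam (-1) ω‖ + (c + W + γ * x)) := by
      rw [hq]
      field_simp [(by linarith : (1 - κ) ≠ 0)]
    rw [hexpand] at hconv
    have hgle : Real.exp (q * (c + W + γ * x)) ≤ g ω := by
      have e : q * (c + W + γ * x) = q * c + (q * W + q * γ * x) := by ring
      rw [e, Real.exp_add]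
      refine mul_le_mul_of_nonneg_left ?_ (Real.exp_pos _).le
      have h3 : Real.exp (q * W + q * γ * x) ≤
          Real.exp (2 * q * W) + Real.exp (2 * q * γ * x) := by
        rcases le_total (q * W) (q * γ * x) with h | h
        · exact (Real.exp_le_exp.2 (by linarith)).trans
            (le_add_of_nonneg_left (Real.exp_pos _).le)
        · exact (Real.exp_le_exp.2 (by linarith)).trans
            (le_add_of_nonneg_right (Real.exp_pos _).le)
      refine h3.trans (add_le_add ?_ ?_)
      · refine le_trans (Real.exp_le_exp.2 ?_) (exp_mul_excess_le p _ _)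
        exact mul_le_mul_of_nonneg_right (by linarith) hW0
      · refine Real.exp_le_exp.2 (mul_le_mul_of_nonneg_right ?_ hx0)
        nlinarith
    calc Real.exp (r * ‖lam 0 ω‖) ≤ Real.exp (r * (κ * ‖lam (-1) ω‖ + (c + W + γ * x))) :=
          Real.exp_le_exp.2 (mul_le_mul_of_nonneg_left hstep hr.le)
      _ ≤ κ * Real.exp (r * ‖lam (-1) ω‖) + (1 - κ) * Real.exp (q * (c + W + γ * x)) := hconv
      _ ≤ _ := by
        gcongr
        exact (mul_le_of_le_one_left (Real.exp_pos _).le (by linarith)).trans hgle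
  have hid := hidL.comp (u := fun x => ENNReal.ofReal (Real.exp (r * ‖x‖))) (by fun_prop)
  have hfin := lintegral_ne_top_of_identDistrib_of_le_mul_add
    (f := fun ω => ENNReal.ofReal (Real.exp (r * ‖lam (-1) ω‖)))
    (f' := fun ω => ENNReal.ofReal (Real.exp (r * ‖lam 0 ω‖)))
    (g := fun ω => ENNReal.ofReal (g ω)) (κ := ENNReal.ofReal κ)
    (ae_of_all _ fun ω => ENNReal.ofReal_ne_top) hid (by simpa using hκ1)
    (by
      filter_upwards [hle] with ω h
      rw [← ENNReal.ofReal_mul hκ0, ← ENNReal.ofReal_add (by positivity) (hg0 ω)]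
      exact ENNReal.ofReal_le_ofReal h)
    hg.aemeasurable.ennreal_ofReal hg.lintegral_lt_top.ne
  have hlm0 := hlm 0
  refine ⟨by fun_prop, ?_⟩
  rw [hasFiniteIntegral_iff_ofReal (ae_of_all _ fun ω => (Real.exp_pos _).le)]
  exact (hid.lintegral_eq.trans_lt (lt_top_iff_ne_top.2 hfin))

end Solution

end BIP

/-- For the counts, `log (1 + Y₂) ≤ W + ‖λ‖ ≤ 2 max (W, ‖λ‖)`, so `(1 + Y₂) ^ r` is bounded by a sum
of two integrable exponentials. -/
theorem mainTheorem12 {Ω : Type*} [MeasurableSpace Ω] (P : Measure Ω) [IsProbabilityMeasure P]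
    (m : ℕ) (d : Fin 2 → ℝ) (B A : Matrix (Fin 2) (Fin 2) ℝ) (Γ : Matrix (Fin 2) (Fin m) ℝ)
    (U : ℤ → Ω → Fin 2 → ℝ) (X : ℤ → Ω → Fin m → ℝ)
    (hUX : BIP.IsDriver P U X)
    (hX : Integrable (fun ω => BIP.l1 (X 0 ω)) P)
    (hrho : BIP.rho (BIP.absMat B + BIP.absMat A * Matrix.diagonal ![1 / 4, 1]) < 1)
    (hnorm : BIP.infNorm (BIP.absMat (BIP.dropFirstCol A) + BIP.absMat B) < 1)
    (hexp : ∀ r : ℝ, 0 < r → Integrable (fun ω => Real.exp (r * BIP.l1 (X 0 ω))) P)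
    (Y : ℤ → Ω → Fin 2 → ℕ) (lam : ℤ → Ω → Fin 2 → ℝ)
    (hsol : BIP.IsStationarySolution P d B A Γ U X Y lam) :
    ∀ r : ℝ, 0 < r →
      Integrable (fun ω => Real.exp (r * BIP.l1 (lam 0 ω))) P ∧
      Integrable (fun ω => BIP.l1 (fun i => (Y 0 ω i : ℝ)) ^ r) P := by
  intro r hr
  have hYm : Measurable (Y 0) := (hsol.adapted_Y 0).mono (hUX.past_le 0) le_rfl
  have hlm : Measurable (lam 0) := (hsol.adapted_lam 0).mono (hUX.past_le 0) le_rfl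
  -- The rate `2 * r` serves both `|x|₁ ≤ 2‖x‖` and the bound by the maximum.
  have hmain := hsol.integrable_exp_norm hUX hnorm hexp (r := 2 * r) (by positivity)
  refine ⟨hmain.mono' (Real.measurable_exp.comp
    ((BIP.measurable_l1.comp hlm).const_mul r)).aestronglyMeasurable (ae_of_all _ fun ω => ?_), ?_⟩
  · rw [Real.norm_eq_abs, Real.abs_exp]
    refine Real.exp_le_exp.2 ?_
    nlinarith [BIP.l1_le_two_mul_norm (lam 0 ω)]
  obtain ⟨p, hp⟩ := exists_nat_ge (2 * r)
  have hcount := hsol.integrable_exp_count hUX 0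
  refine (((integrable_const (1 : ℝ)).add (hcount.const_mul (p.factorial : ℝ))).add
    hmain).mono' ?_ ?_
  · exact ((measurable_of_countable fun y : Fin 2 → ℕ =>
      BIP.l1 (fun i => (y i : ℝ)) ^ r).comp hYm).aestronglyMeasurable
  filter_upwards [hsol.binary 0] with ω h
  have hy : (Y 0 ω 0 : ℝ) ≤ 1 := by
    rw [h, BIP.binaryQuantile]
    split_ifs <;> simp
  have hl : BIP.l1 (fun i => (Y 0 ω i : ℝ)) ≤ 1 + (Y 0 ω 1 : ℝ) := by
    simpa [BIP.l1, Fin.sum_univ_two] using hy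
  have hl0 := BIP.l1_nonneg fun i => (Y 0 ω i : ℝ)
  have hW0 := BIP.excess_nonneg (Y 0 ω 1) (lam 0 ω 1)
  have hWle : Real.log (1 + (Y 0 ω 1 : ℝ)) - |lam 0 ω 1| ≤ BIP.excess (Y 0 ω 1) (lam 0 ω 1) :=
    le_max_right _ _
  have hexc := BIP.exp_mul_excess_le p (Y 0 ω 1) (lam 0 ω 1)
  have hn : |lam 0 ω 1| ≤ ‖lam 0 ω‖ := norm_le_pi_norm (lam 0 ω) 1
  rw [Real.norm_eq_abs, abs_of_nonneg (by positivity)]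
  calc BIP.l1 (fun i => (Y 0 ω i : ℝ)) ^ r ≤ (1 + (Y 0 ω 1 : ℝ)) ^ r := by gcongr
    _ = Real.exp (r * Real.log (1 + (Y 0 ω 1 : ℝ))) := by
      rw [Real.rpow_def_of_pos (by positivity), mul_comm]
    _ ≤ Real.exp (p * BIP.excess (Y 0 ω 1) (lam 0 ω 1)) + Real.exp (2 * r * ‖lam 0 ω‖) := by
      rcases le_total (BIP.excess (Y 0 ω 1) (lam 0 ω 1)) ‖lam 0 ω‖ with h1 | h1
      · refine (Real.exp_le_exp.2 ?_).trans (le_add_of_nonneg_left (Real.exp_pos _).le)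
        nlinarith
      · refine (Real.exp_le_exp.2 ?_).trans (le_add_of_nonneg_right (Real.exp_pos _).le)
        nlinarith
    _ ≤ _ := add_le_add hexc le_rfl
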